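/- Let $G$ be a countable (discrete) amenable group acting by homeomorphisms on compact metric spaces $(X,d)$ and $(Y,d_Y)$, and let $\pi\colon X\to Y$ be a factor map, i.e. a continuous surjection with $\pi(g.x)=g.\pi(x)$ for all $g\in G$, $x\in X$. Put $R(\pi)=\{(x,x')\in X^2:\pi(x)=\pi(x')\}$ and, for $x,x'\in X$, $$D(x,x')=\sup_{(F_n)}\limsup_{n\to\infty}\frac1{|F_n|}\sum_{g\in F_n}d(g.x,g.x'),$$ where the supremum is over all Følner sequences of $G$, i.e. sequences of nonempty finite sets $F_n\subseteq G$ with $|F_n\,\Delta\, gF_n|/|F_n|\to 0$ for all $g\in G$. We use the following notions. - $\pi$ is *topo-isomorphic* if for every $G$-invariant Borel probability measure $\mu$ on $X$ there are Borel sets $N\subseteq X$ and $M\subseteq Y$ with $\mu(N)=1=\pi_*\mu(M)$ such that $\pi$ restricts to a bi-measurable bijection $N\to M$. - $\pi$ is *mean equicontinuous* if for every sequence $(x_n,x_n')$ in $R(\pi)$ converging to some $(x,x')$ one has $D(x_n,x_n')\to 0$ if and only if $D(x,x')=0$. - $\pi$ is *proximal* if $\inf_{g\in G}d(g.x,g.x')=0$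 for all $(x,x')\in R(\pi)$. - $RP(\pi)$ is the set of all limits of convergent sequences $(x_n,x_n')$ in $R(\pi)$ with $\inf_{g\in G}d(g.x_n,g.x_n')\to 0$. **Theorem.** The following statements are equivalent: 1. $\pi$ is topo-isomorphic; 2. $\pi$ is mean equicontinuous and proximal; 3. $\pi$ is mean equicontinuous and $R(\pi)=RP(\pi)$. -/

import Mathlib

open MeasureTheory Filter Topology
open scoped Pointwise symmDiff

namespace FactorMaps

/-- A (left) Følner sequence in a discrete group: a sequence of nonempty finite sets `F n` with
`|F n ∆ g F n| / |F n| → 0` for every `g`. -/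
structure IsFolnerSeq {G : Type*} [Group G] (F : ℕ → Finset G) : Prop where
  nonempty : ∀ n, (F n).Nonempty
  tendsto_symmDiff : ∀ g : G,
    Tendsto (fun n => (((F n : Set G) ∆ (g • (F n : Set G))).ncard : ℝ) / ((F n).card : ℝ))
      atTop (𝓝 0)

/-- Amenability of a countable discrete group: the existence of a Følner sequence. -/
def IsAmenable (G : Type*) [Group G] : Prop :=
  ∃ F : ℕ → Finset G, IsFolnerSeq F

/-- A factor map between two actions of `G`: a continuous equivariant surjection. -/
structure IsFactorMap (G : Type*) {X Y : Type*} [Group G] [TopologicalSpace X]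
    [TopologicalSpace Y] [MulAction G X] [MulAction G Y] (π : X → Y) : Prop where
  continuous : Continuous π
  surjective : Function.Surjective π
  map_smul : ∀ (g : G) (x : X), π (g • x) = g • π x

/-- The fibre relation `R(π)`. -/
def fibreRel {X Y : Type*} (π : X → Y) : Set (X × X) :=
  {p | π p.1 = π p.2}

section Pseudometrics

variable (G : Type*) {X : Type*} [Group G] [MetricSpace X] [MulAction G X]

/-- The Besicovitch pseudometric along a sequence `F` of finite subsets of `G`:
`limsup_n 1/|F n| ∑_{g ∈ F n} d (g x) (g x')`. -/
noncomputable def besicovitchDist {G : Type*} {X : Type*} [Group G] [MetricSpace X]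
    [MulAction G X] (F : ℕ → Finset G) (x x' : X) : ℝ :=
  limsup (fun n => (∑ g ∈ F n, dist (g • x) (g • x')) / ((F n).card : ℝ)) atTop

/-- The Weyl pseudometric `D`: the supremum of the Besicovitch pseudometrics over all Følner
sequences of `G`. -/
noncomputable def weylDist (x x' : X) : ℝ :=
  ⨆ F : {F : ℕ → Finset G // IsFolnerSeq F}, besicovitchDist F.1 x x'

/-- The infimum of the distances along the common orbit of a pair. -/
noncomputable def orbitInfDist (x x' : X) : ℝ :=
  ⨅ g : G, dist (g • x) (g • x')

end Pseudometrics

section Relations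

variable (G : Type*) {X Y : Type*} [Group G] [MetricSpace X] [MulAction G X]

/-- The `π`-proximal relation `P(π)`. -/
def proximalRel (π : X → Y) : Set (X × X) :=
  {p | p ∈ fibreRel π ∧ orbitInfDist G p.1 p.2 = 0}

/-- The `π`-regionally proximal relation `RP(π)`: limits of convergent asymptotically proximal
sequences in `R(π)`. -/
def regionallyProximalRel (π : X → Y) : Set (X × X) :=
  {p | ∃ u : ℕ → X × X, (∀ n, u n ∈ fibreRel π) ∧
    Tendsto (fun n => orbitInfDist G (u n).1 (u n).2) atTop (𝓝 0) ∧
    Tendsto u atTop (𝓝 p)}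

/-- A factor map is proximal if `P(π) = R(π)`. -/
def IsProximalMap (π : X → Y) : Prop :=
  proximalRel G π = fibreRel π

/-- A factor map is mean equicontinuous if for every convergent sequence in `R(π)`, the sequence
is asymptotically Banach proximal if and only if its limit is Banach proximal. -/
def IsMeanEquicontinuousMap (π : X → Y) : Prop :=
  ∀ (u : ℕ → X × X) (p : X × X), (∀ n, u n ∈ fibreRel π) → Tendsto u atTop (𝓝 p) →
    (Tendsto (fun n => weylDist G (u n).1 (u n).2) atTop (𝓝 0) ↔ weylDist G p.1 p.2 = 0)

end Relations

/-- A factor map is topo-isomorphic if for each invariant Borel probability measure `μ` on `X` it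
is an isomorphism modulo null sets from `(X, μ)` to `(Y, π_* μ)`: it restricts to a bi-measurable
bijection from a Borel set of full `μ`-measure onto a Borel set of full `π_* μ`-measure. -/
def IsTopoIsomorphic (G : Type*) {X Y : Type*} [Group G] [MulAction G X] [MeasurableSpace X]
    [MeasurableSpace Y] (π : X → Y) : Prop :=
  ∀ μ : Measure X, IsProbabilityMeasure μ → SMulInvariantMeasure G X μ →
    ∃ (N : Set X) (M : Set Y), MeasurableSet N ∧ MeasurableSet M ∧
      μ N = 1 ∧ μ.map π M = 1 ∧ ∃ e : N ≃ᵐ M, ∀ x : N, (e x : Y) = π x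

end FactorMaps

/-!
Everything is compared with one statement about invariant measures, `HasDiagonalJoinings`: every
invariant probability measure on `X × X` carried by the fibre relation `R(π)` is carried by the
diagonal.

This statement is equivalent to the vanishing of the Weyl pseudometric `D` on `R(π)`. Limits of
empirical measures of a pair in `R(π)` along a Følner sequence are invariant measures on `R(π)`; if
they live on the diagonal, the averages of the distance tend to zero
(`HasDiagonalJoinings.weylDist_eq_zero`). Conversely, the averages of the distance all have the same
integral against an invariant measure, so if they tend to zero pointwise on `R(π)`, the distance
vanishes almost everywhere (`hasDiagonalJoinings_of_weylDist_eq_zero`).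

It is also equivalent to topo-isomorphy. If `π` is injective on a set of full measure for the mean
of the two marginals of a joining on `R(π)`, the joining is diagonal
(`IsTopoIsomorphic.hasDiagonalJoinings`). Conversely, disintegrate an invariant measure over `Y`. Its
relatively independent self-joining is an invariant measure on `R(π)`, and it is diagonal only if
almost every fibre measure is a Dirac measure; then `π` is injective on a Borel set of full measure,
and the Lusin–Souslin theorem supplies the measurable inverse
(`HasDiagonalJoinings.isTopoIsomorphic`).

If `D` vanishes on `R(π)`, then mean equicontinuity is immediate, and so is proximality, since the
average of the distance along an orbit is at least its infimum. Proximality gives `R(π) = RP(π)`.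
Finally, let `π` be mean equicontinuous and let `p ∈ RP(π)` be the limit of pairs whose orbits come
ever closer to the diagonal. Translates of these pairs accumulate at a diagonal point, where `D` is
zero. As `D` is invariant, mean equicontinuity, used once in each direction, yields `D = 0` at `p`
(`IsMeanEquicontinuousMap.weylDist_eq_zero`).
-/

namespace FactorMaps

/-! ### Averages along Følner sequences -/

section Averages

variable {G Z : Type*} [Group G] [MulAction G Z]

/-- The average of `f` over the finite piece `{g • z | g ∈ F}` of the orbit of `z`. -/
noncomputable def orbitAverage (F : Finset G) (f : Z → ℝ) (z : Z) : ℝ :=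
  (∑ g ∈ F, f (g • z)) / (F.card : ℝ)

lemma orbitAverage_mono {F : Finset G} {f₁ f₂ : Z → ℝ} {z : Z} (h : ∀ w, f₁ w ≤ f₂ w) :
    orbitAverage F f₁ z ≤ orbitAverage F f₂ z :=
  div_le_div_of_nonneg_right (Finset.sum_le_sum fun _ _ => h _) (Nat.cast_nonneg _)

lemma orbitAverage_const {F : Finset G} (hF : F.Nonempty) (c : ℝ) (z : Z) :
    orbitAverage F (fun _ => c) z = c := by
  have : (F.card : ℝ) ≠ 0 := by exact_mod_cast hF.card_pos.ne'
  simp only [orbitAverage, Finset.sum_const, nsmul_eq_mul]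
  field_simp

lemma orbitAverage_nonneg {F : Finset G} {f : Z → ℝ} (h : ∀ w, 0 ≤ f w) (z : Z) :
    0 ≤ orbitAverage F f z :=
  div_nonneg (Finset.sum_nonneg fun _ _ => h _) (Nat.cast_nonneg _)

lemma orbitAverage_le {F : Finset G} (hF : F.Nonempty) {f : Z → ℝ} {C : ℝ} (h : ∀ w, f w ≤ C)
    (z : Z) : orbitAverage F f z ≤ C :=
  (orbitAverage_mono h).trans_eq (orbitAverage_const hF C z)

lemma coe_symmDiff_smul_eq [DecidableEq G] (F : Finset G) (h : G) :
    ((F : Set G) ∆ (h • (F : Set G))).ncard = (F ∆ (h • F)).card := by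
  rw [← Set.ncard_coe_finset]
  congr 1
  push_cast
  rfl

/-- Averaging the translate `f (h • ·)` amounts to averaging `f` over `h F`. -/
lemma abs_orbitAverage_smul_sub_le (F : Finset G) (h : G) {f : Z → ℝ} {C : ℝ}
    (hC : ∀ w, |f w| ≤ C) (z : Z) :
    |orbitAverage F (fun w => f (h • w)) z - orbitAverage F f z| ≤
      C * ((((F : Set G) ∆ (h • (F : Set G))).ncard : ℝ) / (F.card : ℝ)) := by
  classical
  have h₁ : ∑ g ∈ F, f (h • g • z) = ∑ g ∈ h • F, f (g • z) := by
    rw [← Finset.image_smul, Finset.sum_image (MulAction.injective h).injOn]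
    simp [mul_smul]
  have h₂ : |∑ g ∈ h • F, f (g • z) - ∑ g ∈ F, f (g • z)| ≤ C * (F ∆ (h • F)).card := by
    rw [← Finset.sum_sdiff_sub_sum_sdiff, symmDiff_comm, Finset.symmDiff_def,
      Finset.card_union_of_disjoint disjoint_sdiff_sdiff]
    have key : ∀ S : Finset G, |∑ g ∈ S, f (g • z)| ≤ C * S.card := fun S =>
      (Finset.abs_sum_le_sum_abs _ _).trans <| (Finset.sum_le_card_nsmul _ _ C fun _ _ => hC _).trans
        (by rw [nsmul_eq_mul, mul_comm])
    refine (abs_sub _ _).trans ((add_le_add (key _) (key _)).trans_eq ?_)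
    push_cast
    ring
  rw [orbitAverage, orbitAverage, h₁, ← sub_div, abs_div, Nat.abs_cast, coe_symmDiff_smul_eq,
    ← mul_div_assoc]
  exact div_le_div_of_nonneg_right h₂ (Nat.cast_nonneg _)

lemma IsFolnerSeq.tendsto_orbitAverage_smul_sub {F : ℕ → Finset G} (hF : IsFolnerSeq F) (h : G)
    {f : Z → ℝ} {C : ℝ} (hC : ∀ w, |f w| ≤ C) (z : Z) :
    Tendsto (fun n => orbitAverage (F n) (fun w => f (h • w)) z - orbitAverage (F n) f z)
      atTop (𝓝 0) := by
  refine squeeze_zero_norm (fun n => abs_orbitAverage_smul_sub_le (F n) h hC z) ?_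
  simpa using (hF.tendsto_symmDiff h).const_mul C

/-- Right translates of a (left) Følner sequence are Følner. -/
lemma IsFolnerSeq.map_mulRight {F : ℕ → Finset G} (hF : IsFolnerSeq F) (h : G) :
    IsFolnerSeq fun n => (F n).map (mulRightEmbedding h) where
  nonempty n := (hF.nonempty n).map
  tendsto_symmDiff g := by
    convert hF.tendsto_symmDiff g using 3 with n
    · have hinj : Function.Injective fun x : G => x * h := mul_left_injective h
      rw [← Set.ncard_image_of_injective ((F n : Set G) ∆ (g • (F n : Set G))) hinj,
        Set.image_symmDiff hinj]
      have hcoe : (((F n).map (mulRightEmbedding h) : Finset G) : Set G) =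
          (fun x : G => x * h) '' (F n : Set G) := by
        rw [Finset.coe_map]
        rfl
      rw [hcoe, ← Set.image_smul, ← Set.image_smul, Set.image_image, Set.image_image]
      simp only [smul_eq_mul, mul_assoc]
    · simp

end Averages

/-! ### The Weyl pseudometric -/

section Weyl

variable {G X : Type*} [Group G] [MetricSpace X] [MulAction G X]

lemma besicovitchDist_eq (F : ℕ → Finset G) (x x' : X) :
    besicovitchDist F x x' =
      limsup (fun n => orbitAverage (F n) (fun p : X × X => dist p.1 p.2) (x, x')) atTop :=
  rfl

lemma weylDist_self (x : X) : weylDist G x x = 0 := by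
  simp [weylDist, besicovitchDist]

/-- Moving the pair by `g` replaces a Følner sequence by its right translate, and right translation
permutes the Følner sequences. -/
lemma weylDist_smul (g : G) (x x' : X) : weylDist G (g • x) (g • x') = weylDist G x x' := by
  refine Function.Surjective.iSup_congr
    (fun F : {F : ℕ → Finset G // IsFolnerSeq F} => ⟨_, F.2.map_mulRight g⟩) ?_ ?_
  · intro F
    refine ⟨⟨_, F.2.map_mulRight g⁻¹⟩, Subtype.ext (funext fun n => ?_)⟩
    ext x
    simp
  · intro F
    simp [besicovitchDist, mul_smul]

lemma orbitInfDist_nonneg (x x' : X) : 0 ≤ orbitInfDist G x x' :=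
  Real.iInf_nonneg fun _ => dist_nonneg

variable [CompactSpace X]

lemma dist_le_diam_univ (x x' : X) : dist x x' ≤ Metric.diam (Set.univ : Set X) :=
  Metric.dist_le_diam_of_mem isCompact_univ.isBounded trivial trivial

lemma IsFolnerSeq.isBoundedUnder_orbitAverage_dist {F : ℕ → Finset G} (hF : IsFolnerSeq F)
    (p : X × X) : IsBoundedUnder (· ≤ ·) atTop
      fun n => orbitAverage (F n) (fun p : X × X => dist p.1 p.2) p :=
  isBoundedUnder_of ⟨_, fun n =>
    orbitAverage_le (hF.nonempty n) (fun q => dist_le_diam_univ q.1 q.2) p⟩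

lemma IsFolnerSeq.besicovitchDist_le_weylDist {F : ℕ → Finset G} (hF : IsFolnerSeq F)
    (x x' : X) : besicovitchDist F x x' ≤ weylDist G x x' := by
  refine le_ciSup (f := fun F : {F : ℕ → Finset G // IsFolnerSeq F} => besicovitchDist F.1 x x')
    ⟨Metric.diam (Set.univ : Set X), ?_⟩ ⟨F, hF⟩
  rintro _ ⟨F, rfl⟩
  refine limsup_le_of_le
    (isBoundedUnder_of ⟨0, fun n => orbitAverage_nonneg (fun _ => dist_nonneg)
      (x, x')⟩ : IsBoundedUnder (· ≥ ·) atTop fun n =>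
        orbitAverage (F.1 n) (fun p : X × X => dist p.1 p.2) (x, x')).isCoboundedUnder_le
    (Eventually.of_forall fun n => ?_)
  exact orbitAverage_le (F.2.nonempty n) (fun q : X × X => dist_le_diam_univ q.1 q.2) (x, x')

/-- The Weyl distance vanishes exactly when the averages of the distance tend to zero along every
Følner sequence. -/
lemma weylDist_eq_zero_iff (hG : IsAmenable G) (x x' : X) :
    weylDist G x x' = 0 ↔ ∀ F : ℕ → Finset G, IsFolnerSeq F →
      Tendsto (fun n => orbitAverage (F n) (fun p : X × X => dist p.1 p.2) (x, x'))
        atTop (𝓝 0) := by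
  constructor
  · intro h F hF
    have hb : IsBoundedUnder (· ≥ ·) atTop fun n =>
        orbitAverage (F n) (fun p : X × X => dist p.1 p.2) (x, x') :=
      isBoundedUnder_of ⟨0, fun n => orbitAverage_nonneg (fun _ => dist_nonneg) _⟩
    have hb' := hF.isBoundedUnder_orbitAverage_dist (x, x')
    refine tendsto_of_le_liminf_of_limsup_le ?_ ?_ hb' hb
    · exact le_liminf_of_le hb'.isCoboundedUnder_ge
        (Eventually.of_forall fun n => orbitAverage_nonneg (fun _ => dist_nonneg) _)
    · exact (hF.besicovitchDist_le_weylDist x x').trans_eq h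
  · intro h
    obtain ⟨F₀, hF₀⟩ := hG
    have : Nonempty {F : ℕ → Finset G // IsFolnerSeq F} := ⟨⟨F₀, hF₀⟩⟩
    have hF : ∀ F : {F : ℕ → Finset G // IsFolnerSeq F}, besicovitchDist F.1 x x' = 0 :=
      fun F => (besicovitchDist_eq F.1 x x').trans (h F.1 F.2).limsup_eq
    simp only [weylDist, hF, ciSup_const]

lemma orbitInfDist_eq_zero_of_weylDist_eq_zero (hG : IsAmenable G) {x x' : X}
    (h : weylDist G x x' = 0) : orbitInfDist G x x' = 0 := by
  obtain ⟨F, hF⟩ := hG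
  refine le_antisymm ?_ (orbitInfDist_nonneg x x')
  refine ge_of_tendsto' ((weylDist_eq_zero_iff ⟨F, hF⟩ x x').1 h F hF) fun n => ?_
  have hcard : (0 : ℝ) < (F n).card := by exact_mod_cast (hF.nonempty n).card_pos
  rw [orbitAverage, le_div_iff₀ hcard, mul_comm, ← nsmul_eq_mul]
  exact Finset.card_nsmul_le_sum _ _ _ fun g _ =>
    ciInf_le ⟨0, by rintro _ ⟨g, rfl⟩; exact dist_nonneg⟩ g

end Weyl

section Proximality

variable {G X Y : Type*} [Group G] [MetricSpace X] [MulAction G X] {π : X → Y}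

lemma IsProximalMap.fibreRel_eq_regionallyProximalRel [TopologicalSpace Y] [T2Space Y]
    (hπ : Continuous π) (h : IsProximalMap G π) : fibreRel π = regionallyProximalRel G π := by
  refine Set.Subset.antisymm (fun p hp => ?_) ?_
  · have hp' : p ∈ proximalRel G π := h.symm ▸ hp
    exact ⟨fun _ => p, fun _ => hp, by simp [hp'.2], tendsto_const_nhds⟩
  · rintro p ⟨u, hu, -, hup⟩
    have hcl : IsClosed (fibreRel π) :=
      isClosed_eq (hπ.comp continuous_fst) (hπ.comp continuous_snd)
    exact hcl.mem_of_tendsto hup (Eventually.of_forall hu)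

/-- If the orbits of `u n` come close to the diagonal, then translates of `u n` accumulate at a
diagonal point, where the Weyl distance vanishes; mean equicontinuity and invariance of the Weyl
distance carry this over to the limit of `u n`. -/
lemma IsMeanEquicontinuousMap.weylDist_eq_zero [CompactSpace X]
    (hfib : ∀ p ∈ fibreRel π, ∀ g : G, g • p ∈ fibreRel π)
    (h : IsMeanEquicontinuousMap G π) {p : X × X} (hp : p ∈ regionallyProximalRel G π) :
    weylDist G p.1 p.2 = 0 := by
  obtain ⟨u, hu, hinf, hup⟩ := hp
  have hex : ∀ n : ℕ, ∃ g : G,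
      dist (g • (u n).1) (g • (u n).2) < orbitInfDist G (u n).1 (u n).2 + 1 / ((n : ℝ) + 1) :=
    fun n => exists_lt_of_ciInf_lt (lt_add_of_pos_right _ Nat.one_div_pos_of_nat)
  choose g hg using hex
  obtain ⟨q, -, φ, hφ, hq⟩ := isCompact_univ.tendsto_subseq
    (x := fun n => g n • u n) fun _ => Set.mem_univ _
  have hdist : Tendsto (fun n => dist (g n • (u n).1) (g n • (u n).2)) atTop (𝓝 0) := by
    refine squeeze_zero (fun _ => dist_nonneg) (fun n => (hg n).le) ?_
    simpa using hinf.add tendsto_one_div_add_atTop_nhds_zero_nat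
  have hq0 : dist q.1 q.2 = 0 :=
    tendsto_nhds_unique ((continuous_dist.tendsto q).comp hq) (hdist.comp hφ.tendsto_atTop)
  have hqD : weylDist G q.1 q.2 = 0 := by rw [dist_eq_zero.1 hq0, weylDist_self]
  have h₁ := (h _ q (fun n => hfib _ (hu (φ n)) (g (φ n))) hq).2 hqD
  refine (h (u ∘ φ) p (fun n => hu _) (hup.comp hφ.tendsto_atTop)).1 ?_
  simpa [weylDist_smul] using h₁

end Proximality

/-! ### Invariant measures as limits of empirical measures -/

section KrylovBogolyubov

variable {G Z : Type*} [Group G] [MulAction G Z] [MeasurableSpace Z]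

/-- The uniform probability measure on the points `g • z`, `g ∈ F`, counted with multiplicity. -/
noncomputable def empiricalMeasure (F : Finset G) (z : Z) : Measure Z :=
  (F.card : ENNReal)⁻¹ • ∑ g ∈ F, Measure.dirac (g • z)

lemma isProbabilityMeasure_empiricalMeasure {F : Finset G} (hF : F.Nonempty) (z : Z) :
    IsProbabilityMeasure (empiricalMeasure F z) := by
  refine ⟨?_⟩
  have : (F.card : ENNReal) ≠ 0 := by exact_mod_cast hF.card_pos.ne'
  simp [empiricalMeasure, ENNReal.inv_mul_cancel this]

lemma integral_empiricalMeasure [TopologicalSpace Z] [OpensMeasurableSpace Z]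
    (F : Finset G) (z : Z) {f : Z → ℝ} (hf : Continuous f) :
    ∫ w, f w ∂(empiricalMeasure F z) = orbitAverage F f z := by
  have hs := hf.stronglyMeasurable
  rw [empiricalMeasure, integral_smul_measure, integral_finsetSum_measure
    fun g _ => integrable_dirac' hs (by simp)]
  simp [integral_dirac' _ _ hs, orbitAverage, div_eq_inv_mul]

variable [TopologicalSpace Z] [CompactSpace Z] [T2Space Z] [HasOuterApproxClosed Z] [BorelSpace Z]
  [ContinuousConstSMul G Z]

/-- The Krylov–Bogolyubov argument: along any ultrafilter, the averages of all continuous functions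
over a Følner sequence converge to their integrals against one invariant measure. -/
lemma IsFolnerSeq.exists_smulInvariantMeasure {F : ℕ → Finset G} (hF : IsFolnerSeq F) (z : Z)
    (U : Ultrafilter ℕ) (hU : (U : Filter ℕ) ≤ atTop) :
    ∃ μ : Measure Z, IsProbabilityMeasure μ ∧ SMulInvariantMeasure G Z μ ∧
      ∀ f : Z → ℝ, Continuous f →
        Tendsto (fun n => orbitAverage (F n) f z) U (𝓝 (∫ w, f w ∂μ)) := by
  let P : ℕ → ProbabilityMeasure Z := fun n =>
    ⟨empiricalMeasure (F n) z, isProbabilityMeasure_empiricalMeasure (hF.nonempty n) z⟩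
  have hlim : ∃ μ, Tendsto P U (𝓝 μ) := by
    obtain ⟨μ, -, hμ⟩ := isCompact_univ.ultrafilter_le_nhds (U.map P) (by simp)
    exact ⟨μ, hμ⟩
  obtain ⟨μ, hμ⟩ := hlim
  have hconv : ∀ f : Z → ℝ, Continuous f →
      Tendsto (fun n => orbitAverage (F n) f z) U (𝓝 (∫ w, f w ∂(μ : Measure Z))) := by
    intro f hf
    have := ProbabilityMeasure.tendsto_iff_forall_integral_tendsto.1 hμ
      (BoundedContinuousFunction.mkOfCompact ⟨f, hf⟩)
    refine this.congr fun n => ?_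
    exact integral_empiricalMeasure (F n) z hf
  refine ⟨μ, inferInstance, ?_, hconv⟩
  refine ((smulInvariantMeasure_tfae G (μ : Measure Z)).out 0 5).2 fun h => ?_
  have hm : Measurable fun w : Z => h • w := measurable_const_smul h
  have := Measure.isProbabilityMeasure_map (μ := (μ : Measure Z)) hm.aemeasurable
  refine ext_of_forall_integral_eq_of_IsFiniteMeasure fun f => ?_
  rw [integral_map hm.aemeasurable f.continuous.aestronglyMeasurable]
  have h₁ := hconv (fun w => f (h • w)) (f.continuous.comp (continuous_const_smul h))
  have h₂ := hconv f f.continuous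
  have h₃ := (hF.tendsto_orbitAverage_smul_sub h (f := f) (C := ‖f‖)
    (fun w => f.norm_coe_le_norm w) z).mono_left hU
  exact sub_eq_zero.1 (tendsto_nhds_unique (h₁.sub h₂) h₃)

end KrylovBogolyubov

lemma integral_orbitAverage {G Z : Type*} [Group G] [MulAction G Z] [MeasurableSpace Z]
    [MeasurableConstSMul G Z] {μ : Measure Z} [SMulInvariantMeasure G Z μ] {F : Finset G}
    (hF : F.Nonempty) {f : Z → ℝ} (hf : Integrable f μ) :
    ∫ z, orbitAverage F f z ∂μ = ∫ z, f z ∂μ := by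
  have hcard : (F.card : ℝ) ≠ 0 := by exact_mod_cast hF.card_pos.ne'
  have hmp := fun g : G => measurePreserving_smul g μ
  simp only [orbitAverage]
  have hint : ∀ g ∈ F, Integrable (fun z => f (g • z)) μ := fun g _ =>
    (hmp g).integrable_comp_of_integrable hf
  rw [integral_div, integral_finsetSum _ hint]
  simp only [fun g : G => (hmp g).integral_comp (measurableEmbedding_const_smul g) f,
    Finset.sum_const, nsmul_eq_mul]
  field_simp

/-! ### Vanishing of the Weyl distance and invariant measures on the fibre relation -/

/-- Every invariant probability measure on `X × X` carried by the fibre relation of `π` is carried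
by the diagonal; that is, two lifts to `X` of an invariant measure on `Y` admit only the trivial
joining over `Y`. -/
def HasDiagonalJoinings (G : Type*) {X Y : Type*} [Group G] [MulAction G X] [MeasurableSpace X]
    (π : X → Y) : Prop :=
  ∀ μ : Measure (X × X), IsProbabilityMeasure μ → SMulInvariantMeasure G (X × X) μ →
    (∀ᵐ p ∂μ, p ∈ fibreRel π) → ∀ᵐ p ∂μ, p.1 = p.2

section Joinings

variable {G X Y : Type*} [Group G] [MulAction G X] {π : X → Y}

lemma IsFactorMap.smul_mem_fibreRel [MulAction G Y] [TopologicalSpace X] [TopologicalSpace Y]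
    (hπ : IsFactorMap G π) {p : X × X} (hp : p ∈ fibreRel π) (g : G) : g • p ∈ fibreRel π := by
  have hp' : π p.1 = π p.2 := hp
  change π (g • p.1) = π (g • p.2)
  rw [hπ.map_smul, hπ.map_smul, hp']

lemma smulInvariantMeasure_map_of_smul {G Z W : Type*} [Group G] [MulAction G Z] [MulAction G W]
    [MeasurableSpace Z] [MeasurableSpace W] [MeasurableConstSMul G Z] [MeasurableConstSMul G W]
    {f : Z → W} (hf : Measurable f) (hfg : ∀ (g : G) z, f (g • z) = g • f z) (μ : Measure Z)
    [SMulInvariantMeasure G Z μ] : SMulInvariantMeasure G W (μ.map f) := by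
  refine ((smulInvariantMeasure_tfae G (μ.map f)).out 0 5).2 fun g => ?_
  have h := (measurePreserving_smul g μ).map_eq
  rw [Measure.map_map (measurable_const_smul g) hf]
  conv_rhs => rw [← h]
  rw [Measure.map_map hf (measurable_const_smul g)]
  congr 1
  ext z
  exact (hfg g z).symm

variable [MetricSpace X] [CompactSpace X] [MeasurableSpace X] [BorelSpace X]
  [ContinuousConstSMul G X]

/-- A limit of empirical measures of a pair in the fibre relation is carried by the fibre relation,
hence by the diagonal, so that it integrates the distance to zero. -/
lemma HasDiagonalJoinings.weylDist_eq_zero [MulAction G Y] [MetricSpace Y]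
    (hG : IsAmenable G) (hπ : IsFactorMap G π)
    (h : HasDiagonalJoinings G π) {p : X × X} (hp : p ∈ fibreRel π) :
    weylDist G p.1 p.2 = 0 := by
  refine (weylDist_eq_zero_iff hG _ _).2 fun F hF => (tendsto_iff_ultrafilter _ _ _).2
    fun U hU => ?_
  obtain ⟨μ, hμP, hμI, hμ⟩ := hF.exists_smulInvariantMeasure p U hU
  have hcont : Continuous fun q : X × X => dist (π q.1) (π q.2) :=
    (hπ.continuous.comp continuous_fst).dist (hπ.continuous.comp continuous_snd)
  have hint : ∀ {f : X × X → ℝ}, Continuous f → Integrable f μ := fun hf =>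
    hf.integrable_of_hasCompactSupport (HasCompactSupport.of_compactSpace _)
  have hfib : ∀ᵐ q ∂μ, q ∈ fibreRel π := by
    have h0 : ∫ q, dist (π q.1) (π q.2) ∂μ = 0 := by
      refine tendsto_nhds_unique (hμ _ hcont) ?_
      have : ∀ n, orbitAverage (F n) (fun q : X × X => dist (π q.1) (π q.2)) p = 0 := by
        intro n
        simp only [orbitAverage]
        rw [Finset.sum_eq_zero, zero_div]
        exact fun g _ => dist_eq_zero.2 (hπ.smul_mem_fibreRel hp g)
      simp only [this]
      exact tendsto_const_nhds
    filter_upwards [(integral_eq_zero_iff_of_nonneg (fun _ => dist_nonneg) (hint hcont)).1 h0]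
      with q hq using dist_eq_zero.1 hq
  have hzero : ∫ q : X × X, dist q.1 q.2 ∂μ = 0 := by
    rw [integral_eq_zero_of_ae]
    filter_upwards [h μ hμP hμI hfib] with q hq
    simp [hq]
  have := hμ (fun q : X × X => dist q.1 q.2) continuous_dist
  rwa [hzero] at this

/-- The averages of the distance have constant integral against an invariant measure, and tend to
zero pointwise. -/
lemma hasDiagonalJoinings_of_weylDist_eq_zero (hG : IsAmenable G)
    (h : ∀ p ∈ fibreRel π, weylDist G p.1 p.2 = 0) : HasDiagonalJoinings G π := by
  intro μ hμP hμI hfib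
  obtain ⟨F, hF⟩ := id hG
  have hint : Integrable (fun q : X × X => dist q.1 q.2) μ :=
    continuous_dist.integrable_of_hasCompactSupport (HasCompactSupport.of_compactSpace _)
  have hzero : ∫ q : X × X, dist q.1 q.2 ∂μ = 0 := by
    have hlim : Tendsto
        (fun n => ∫ q, orbitAverage (F n) (fun q : X × X => dist q.1 q.2) q ∂μ) atTop
        (𝓝 (∫ _, (0 : ℝ) ∂μ)) := by
      refine tendsto_integral_of_dominated_convergence
        (fun _ => Metric.diam (Set.univ : Set X)) (fun n => ?_) (integrable_const _)
        (fun n => Eventually.of_forall fun q => ?_) ?_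
      · refine Continuous.aestronglyMeasurable ?_
        exact (continuous_finsetSum _ fun g _ =>
          continuous_dist.comp (continuous_const_smul g)).div_const _
      · rw [Real.norm_of_nonneg (orbitAverage_nonneg (fun _ => dist_nonneg) q)]
        exact orbitAverage_le (hF.nonempty n) (fun q : X × X => dist_le_diam_univ q.1 q.2) q
      · filter_upwards [hfib] with q hq
        exact (weylDist_eq_zero_iff hG q.1 q.2).1 (h q hq) F hF
    simp only [fun n => integral_orbitAverage (hF.nonempty n) hint, integral_zero] at hlim
    exact tendsto_nhds_unique tendsto_const_nhds hlim
  filter_upwards [(integral_eq_zero_iff_of_nonneg (fun _ => dist_nonneg) hint).1 hzero]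
    with q hq using dist_eq_zero.1 hq

end Joinings

/-! ### Topo-isomorphy and joinings over the factor -/

section TopoIsomorphic

open ProbabilityTheory

variable {G X Y : Type*} [Group G] [MulAction G X] [MetricSpace X] [CompactSpace X]
  [MeasurableSpace X] [BorelSpace X] [ContinuousConstSMul G X] {π : X → Y}

/-- Apply topo-isomorphy to the mean of the two marginals: the set where `π` is injective then has
full measure for both of them. -/
lemma IsTopoIsomorphic.hasDiagonalJoinings [MeasurableSpace Y] (h : IsTopoIsomorphic G π) :
    HasDiagonalJoinings G π := by
  intro μ hμP hμI hfib
  have := smulInvariantMeasure_map_of_smul (G := G) measurable_fst (fun _ _ => rfl) μ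
  have := smulInvariantMeasure_map_of_smul (G := G) measurable_snd (fun _ _ => rfl) μ
  have := Measure.isProbabilityMeasure_map (μ := μ) measurable_fst.aemeasurable
  have := Measure.isProbabilityMeasure_map (μ := μ) measurable_snd.aemeasurable
  let m : Measure X := (2⁻¹ : ENNReal) • (μ.map Prod.fst + μ.map Prod.snd)
  have hmP : IsProbabilityMeasure m := ⟨by
    simp only [m, Measure.smul_apply, Measure.add_apply, measure_univ, smul_eq_mul]
    rw [one_add_one_eq_two, ENNReal.inv_mul_cancel (by simp) (by simp)]⟩
  have hmI : SMulInvariantMeasure G X m := inferInstance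
  obtain ⟨N, M, hN, -, hmN, -, e, he⟩ := h m hmP hmI
  have hmN' : m Nᶜ = 0 := (prob_compl_eq_zero_iff hN).2 hmN
  simp only [m, Measure.smul_apply, Measure.add_apply, smul_eq_mul, mul_eq_zero,
    ENNReal.inv_eq_zero, ENNReal.ofNat_ne_top, false_or, add_eq_zero] at hmN'
  have h₁ : ∀ᵐ p ∂μ, p.1 ∈ N := ae_of_ae_map measurable_fst.aemeasurable hmN'.1
  have h₂ : ∀ᵐ p ∂μ, p.2 ∈ N := ae_of_ae_map measurable_snd.aemeasurable hmN'.2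
  filter_upwards [hfib, h₁, h₂] with p hp hp₁ hp₂
  have : e ⟨p.1, hp₁⟩ = e ⟨p.2, hp₂⟩ := Subtype.ext (by rw [he, he]; exact hp)
  exact congrArg Subtype.val (e.injective this)

variable [MetricSpace Y] [MeasurableSpace Y] [BorelSpace Y] [MulAction G Y]
  [ContinuousConstSMul G Y]

/-- The disintegration of an invariant measure over a factor is equivariant. -/
lemma IsFactorMap.condDistrib_smul_ae_eq [Nonempty X] (hπ : IsFactorMap G π) (μ : Measure X)
    [IsProbabilityMeasure μ] [SMulInvariantMeasure G X μ] (g : G) :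
    ∀ᵐ y ∂(μ.map π), (condDistrib id π μ y).map (g • ·) = condDistrib id π μ (g • y) := by
  have hπm := hπ.continuous.measurable
  have hgX : Measurable fun x : X => g • x := measurable_const_smul g
  have hgY : Measurable fun y : Y => g • y := measurable_const_smul g
  have hν := smulInvariantMeasure_map_of_smul hπm hπ.map_smul μ
  have := Measure.isProbabilityMeasure_map (μ := μ) hπm.aemeasurable
  -- Both sides disintegrate the image of `μ` under `x ↦ (π x, g • x)`.
  have hcomp : μ.map (fun x => (π x, g • x)) =
      μ.map π ⊗ₘ ((condDistrib id π μ).comap (g • ·) hgY) := by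
    have := Measure.isProbabilityMeasure_map (μ := μ)
      (hπm.prodMk hgX).aemeasurable
    refine Measure.ext_prod fun {s t} hs ht => ?_
    rw [Measure.compProd_apply_prod hs ht, Measure.map_apply (hπm.prodMk hgX) (hs.prod ht)]
    have hs' : MeasurableSet ((g⁻¹ • ·) ⁻¹' s : Set Y) := measurable_const_smul g⁻¹ hs
    have h₁ : (fun x => (π x, g • x)) ⁻¹' s ×ˢ t =
        (g • ·) ⁻¹' ((fun x => (π x, id x)) ⁻¹' (((g⁻¹ • ·) ⁻¹' s) ×ˢ t)) := by
      ext x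
      simp [hπ.map_smul]
    rw [h₁, measure_preimage_smul, ← Measure.map_apply (hπm.prodMk measurable_id) (hs'.prod ht),
      ← compProd_map_condDistrib measurable_id.aemeasurable,
      Measure.compProd_apply_prod hs' ht]
    rw [← (measurePreserving_smul g (μ.map π)).setLIntegral_comp_preimage hs'
      (Kernel.measurable_coe _ ht)]
    have h₂ : (g • ·) ⁻¹' ((g⁻¹ • ·) ⁻¹' s : Set Y) = s := by
      ext y
      simp
    rw [h₂]
    simp [Kernel.comap_apply]
  have h₁ := condDistrib_ae_eq_of_measure_eq_compProd (μ := μ) π hgX.aemeasurable hcomp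
  have h₂ := condDistrib_comp (mβ := ‹MeasurableSpace Y›) (μ := μ) π (Y := id) measurable_id.aemeasurable hgX
  filter_upwards [h₁, h₂] with y hy₁ hy₂
  rw [← Kernel.map_apply _ hgX, ← hy₂, Function.comp_id, hy₁, Kernel.comap_apply]

variable [CompactSpace Y]

/-- Almost every fibre measure of a disintegration over `π` lives on the corresponding fibre. -/
lemma ae_condDistrib_id_eq [Nonempty X] (hπ : Measurable π) (μ : Measure X)
    [IsProbabilityMeasure μ] :
    ∀ᵐ y ∂(μ.map π), ∀ᵐ x ∂(condDistrib id π μ y), π x = y := by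
  have := Measure.isProbabilityMeasure_map (μ := μ) hπ.aemeasurable
  have hmeas : MeasurableSet {q : Y × X | π q.2 = q.1} :=
    measurableSet_eq_fun (hπ.comp measurable_snd) measurable_fst
  refine Measure.ae_ae_of_ae_compProd (p := fun q : Y × X => π q.2 = q.1) ?_
  rw [compProd_map_condDistrib measurable_id.aemeasurable]
  exact (ae_map_iff (hπ.prodMk measurable_id).aemeasurable hmeas).2 (by simp)

/-- The relatively independent self-joining of `μ` over `π` is an invariant measure on the fibre
relation. -/
lemma HasDiagonalJoinings.ae_condDistrib [Nonempty X] (hπ : IsFactorMap G π)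
    (h : HasDiagonalJoinings G π) (μ : Measure X) [IsProbabilityMeasure μ]
    [SMulInvariantMeasure G X μ] :
    ∀ᵐ y ∂(μ.map π), ∀ᵐ x ∂(condDistrib id π μ y), condDistrib id π μ y {x}ᶜ = 0 := by
  have hπm := hπ.continuous.measurable
  have := Measure.isProbabilityMeasure_map (μ := μ) hπm.aemeasurable
  have hν := smulInvariantMeasure_map_of_smul hπm hπ.map_smul μ
  set κ := condDistrib id π μ with hκ
  have hinv : SMulInvariantMeasure G (X × X) ((κ ×ₖ κ) ∘ₘ μ.map π) := by
    refine ((smulInvariantMeasure_tfae G _).out 0 5).2 fun g => ?_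
    have hgX : Measurable fun x : X => g • x := measurable_const_smul g
    have hgY : Measurable fun y : Y => g • y := measurable_const_smul g
    have hgXX : Measurable fun p : X × X => g • p := measurable_const_smul g
    ext s hs
    rw [Measure.map_apply hgXX hs, Measure.bind_apply (hgXX hs) (Kernel.aemeasurable _),
      Measure.bind_apply hs (Kernel.aemeasurable _),
      ← (measurePreserving_smul g (μ.map π)).lintegral_comp (Kernel.measurable_coe _ hs)]
    refine lintegral_congr_ae ?_
    filter_upwards [hπ.condDistrib_smul_ae_eq μ g] with y hy
    rw [Kernel.prod_apply, Kernel.prod_apply, ← hy, ← hκ, Measure.map_prod_map _ _ hgX hgX,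
      Measure.map_apply (hgX.prodMap hgX) hs]
    rfl
  have hfib : ∀ᵐ p ∂((κ ×ₖ κ) ∘ₘ μ.map π), p ∈ fibreRel π := by
    refine Measure.ae_comp_of_ae_ae
      (measurableSet_eq_fun (hπm.comp measurable_fst) (hπm.comp measurable_snd)) ?_
    filter_upwards [ae_condDistrib_id_eq hπm μ] with y hy
    rw [Kernel.prod_apply]
    filter_upwards [Measure.quasiMeasurePreserving_fst.ae hy,
      Measure.quasiMeasurePreserving_snd.ae hy] with p hp₁ hp₂ using hp₁.trans hp₂.symm
  filter_upwards [Measure.ae_ae_of_ae_comp (h _ inferInstance hinv hfib)] with y hy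
  rw [Kernel.prod_apply] at hy
  filter_upwards [Measure.ae_ae_of_ae_prod hy] with x hx
  refine measure_mono_null (fun x' hx' => ?_) hx
  exact fun h => hx' h.symm

/-- The fibre measures of `μ` being Dirac measures, `π` is injective on the full measure set of
those points at which the fibre measure is concentrated; by the Lusin–Souslin theorem it is
a Borel isomorphism from this set onto its image. -/
lemma HasDiagonalJoinings.isTopoIsomorphic (hπ : IsFactorMap G π)
    (h : HasDiagonalJoinings G π) : IsTopoIsomorphic G π := by
  intro μ hμP hμI
  have hπm := hπ.continuous.measurable
  have : Nonempty X := nonempty_of_isProbabilityMeasure μ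
  have := Measure.isProbabilityMeasure_map (μ := μ) hπm.aemeasurable
  set κ := condDistrib id π μ with hκ
  have hconc : MeasurableSet {q : Y × X | κ q.1 {q.2}ᶜ = 0} := by
    have hne : MeasurableSet {r : (Y × X) × X | r.2 ≠ r.1.2} :=
      (measurableSet_eq_fun measurable_snd (measurable_snd.comp measurable_fst)).compl
    exact Kernel.measurable_kernel_prodMk_left (κ := κ.comap Prod.fst measurable_fst) hne
      (measurableSet_singleton 0)
  let N : Set X := {x | κ (π x) {x}ᶜ = 0}
  have hN : MeasurableSet N := (hπm.prodMk measurable_id) hconc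
  have hμN : μ N = 1 := by
    have hae : ∀ᵐ q ∂(μ.map π ⊗ₘ κ), κ q.1 {q.2}ᶜ = 0 :=
      Measure.ae_compProd_of_ae_ae hconc (h.ae_condDistrib hπ μ)
    rw [compProd_map_condDistrib measurable_id.aemeasurable] at hae
    have := ae_of_ae_map (hπm.prodMk measurable_id).aemeasurable hae
    exact (prob_compl_eq_zero_iff hN).1 this
  have hinj : Function.Injective fun x : N => π x := by
    rintro ⟨x, hx⟩ ⟨x', hx'⟩ hxx'
    have hxx' : π x = π x' := hxx'
    have hx : κ (π x) {x}ᶜ = 0 := hx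
    have hx' : κ (π x') {x'}ᶜ = 0 := hx'
    rw [← hxx'] at hx'
    by_contra hne
    have huniv : (Set.univ : Set X) ⊆ {x}ᶜ ∪ {x'}ᶜ := fun z _ => by
      by_contra hz
      simp only [Set.mem_union, Set.mem_compl_iff, Set.mem_singleton_iff, not_or, not_not] at hz
      exact hne (Subtype.ext (hz.1.symm.trans hz.2))
    exact one_ne_zero ((measure_univ (μ := κ (π x))).symm.trans
      (measure_mono_null huniv (measure_union_null hx hx')))
  have : StandardBorelSpace N := hN.standardBorel
  have hemb : MeasurableEmbedding fun x : N => π x :=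
    (hπm.comp measurable_subtype_coe).measurableEmbedding hinj
  refine ⟨N, Set.range fun x : N => π x, hN, hemb.measurableSet_range, hμN, ?_,
    hemb.equivRange, fun x => by rw [hemb.equivRange_apply]⟩
  rw [Measure.map_apply hπm hemb.measurableSet_range]
  refine le_antisymm prob_le_one (hμN.symm.le.trans (measure_mono fun x hx => ?_))
  exact ⟨⟨x, hx⟩, rfl⟩

end TopoIsomorphic

end FactorMaps

theorem mainTheorem2 {G X Y : Type*} [Group G] [Countable G] (hG : FactorMaps.IsAmenable G)
    [MetricSpace X] [CompactSpace X] [MeasurableSpace X] [BorelSpace X]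
    [MulAction G X] [ContinuousConstSMul G X]
    [MetricSpace Y] [CompactSpace Y] [MeasurableSpace Y] [BorelSpace Y]
    [MulAction G Y] [ContinuousConstSMul G Y]
    (π : X → Y) (hπ : FactorMaps.IsFactorMap G π) :
    List.TFAE [
      FactorMaps.IsTopoIsomorphic G π,
      FactorMaps.IsMeanEquicontinuousMap G π ∧ FactorMaps.IsProximalMap G π,
      FactorMaps.IsMeanEquicontinuousMap G π ∧
        FactorMaps.fibreRel π = FactorMaps.regionallyProximalRel G π] := by
  tfae_have 1 → 2 := by
    intro h
    have hD : ∀ p ∈ FactorMaps.fibreRel π, FactorMaps.weylDist G p.1 p.2 = 0 := fun p hp =>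
      h.hasDiagonalJoinings.weylDist_eq_zero hG hπ hp
    have hcl : IsClosed (FactorMaps.fibreRel π) :=
      isClosed_eq (hπ.continuous.comp continuous_fst) (hπ.continuous.comp continuous_snd)
    refine ⟨fun u p hu hup => ?_, Set.Subset.antisymm (fun p hp => hp.1) fun p hp => ⟨hp, ?_⟩⟩
    · have hp := hcl.mem_of_tendsto hup (Eventually.of_forall hu)
      simp [hD _ hp, fun n => hD _ (hu n)]
    · exact FactorMaps.orbitInfDist_eq_zero_of_weylDist_eq_zero hG (hD p hp)
  tfae_have 2 → 3 := fun h => ⟨h.1, h.2.fibreRel_eq_regionallyProximalRel hπ.continuous⟩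
  tfae_have 3 → 1 := by
    rintro ⟨hme, hRP⟩
    refine (FactorMaps.hasDiagonalJoinings_of_weylDist_eq_zero hG fun p hp => ?_).isTopoIsomorphic
      hπ
    exact hme.weylDist_eq_zero (fun q hq g => hπ.smul_mem_fibreRel hq g) (hRP ▸ hp)
  tfae_finish
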